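/- Let $n \ge 1$, let $\mathbb{B}^n$ be the open Euclidean unit ball of $\mathbb{R}^n$, and let $\rho(x,y) = \inf_\gamma \int_\gamma \frac{2\,|dz|}{1-|z|^2}$ be its hyperbolic metric, where the infimum is taken over all rectifiable curves $\gamma$ in $\mathbb{B}^n$ joining $x$ and $y$. Let $q$ be the chordal metric on $\overline{\mathbb{R}^n} = \mathbb{R}^n \cup \{\infty\}$: $q(x,y) = \frac{|x-y|}{\sqrt{1+|x|^2}\sqrt{1+|y|^2}}$ for $x, y \in \mathbb{R}^n$, $q(x,\infty) = q(\infty,x) = \frac{1}{\sqrt{1+|x|^2}}$ for $x \in \mathbb{R}^n$, and $q(\infty,\infty) = 0$. Write $B_\rho(x,r) = \{y \in \mathbb{B}^n : \rho(x,y) < r\}$ and $B_q(x,s) = \{y \in \overline{\mathbb{R}^n} : q(x,y) < s\}$. Let $x \in \mathbb{B}^n$ and, for $r > 0$, $$m(r) = \frac{(1-|x|^2)\sinh\frac r2}{\sqrt{1+|x|^2}\,\sqrt{(1+|x|^2)\cosh r + 2|x|\sinh r}}, \qquad M(r) = \frac{(1-|x|^2)\sinh\frac r2}{\sqrt{1+|x|^2}\,\sqrt{(1+|x|^2)\cosh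 r - 2|x|\sinh r}}.$$ Then for every $r > 0$ $$B_q(x,m(r)) \subset B_\rho(x,r) \subset B_q(x,M(r)).$$ The inclusions are sharp: for every $r > 0$ and every real $s$, if $B_q(x,s) \subset B_\rho(x,r)$ then $s \le m(r)$, and if $B_\rho(x,r) \subset B_q(x,s)$ then $M(r) \le s$. Moreover, $M(r)/m(r) \to 1$ as $r \to 0^+$. -/

import Mathlib

open Set Filter Topology
open scoped OnePoint

/-- The metric ball `{y ∈ X | d x y < r}` of a distance function `d` on the set `X`. -/
def metricBall {α : Type*} (X : Set α) (d : α → α → ℝ) (x : α) (r : ℝ) : Set α :=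
  {y ∈ X | d x y < r}

/-- The open Euclidean unit ball of `ℝⁿ`. -/
def unitBall (n : ℕ) : Set (EuclideanSpace ℝ (Fin n)) := Metric.ball 0 1

/-- `γ` restricted to `[a, b]` is a rectifiable curve in `G` joining `x` to `y`. -/
structure IsRectifiableCurve {n : ℕ} (G : Set (EuclideanSpace ℝ (Fin n)))
    (x y : EuclideanSpace ℝ (Fin n)) (γ : ℝ → EuclideanSpace ℝ (Fin n)) (a b : ℝ) : Prop where
  le : a ≤ b
  continuousOn : ContinuousOn γ (Icc a b)
  boundedVariationOn : BoundedVariationOn γ (Icc a b)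
  mapsTo : MapsTo γ (Icc a b) G
  source : γ a = x
  target : γ b = y

/-- The line integral `∫_γ w |dz|` over the rectifiable curve `γ` on `[a, b]`: the integral of `w`
along the arc length parametrization of `γ`, over `[0, L]` with `L` the Euclidean length of `γ`. -/
noncomputable def arcLengthIntegral {n : ℕ} (w : EuclideanSpace ℝ (Fin n) → ℝ)
    (γ : ℝ → EuclideanSpace ℝ (Fin n)) (a b : ℝ) : ℝ :=
  ∫ s in (0 : ℝ)..(eVariationOn γ (Icc a b)).toReal, w (naturalParameterization γ (Icc a b) a s)

/-- The hyperbolic length of a rectifiable curve in the unit ball. -/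
noncomputable def hyperbolicLength {n : ℕ} (γ : ℝ → EuclideanSpace ℝ (Fin n)) (a b : ℝ) : ℝ :=
  arcLengthIntegral (fun z => 2 / (1 - ‖z‖ ^ 2)) γ a b

/-- The hyperbolic metric of the unit ball: the infimum of the hyperbolic lengths of all rectifiable
curves in the unit ball that join the two points. -/
noncomputable def hyperbolicDist {n : ℕ} (x y : EuclideanSpace ℝ (Fin n)) : ℝ :=
  sInf {l : ℝ | ∃ (γ : ℝ → EuclideanSpace ℝ (Fin n)) (a b : ℝ),
    IsRectifiableCurve (unitBall n) x y γ a b ∧ l = hyperbolicLength γ a b}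

/-- The chordal metric on `ℝⁿ ∪ {∞}`. -/
noncomputable def chordalDist {n : ℕ} :
    OnePoint (EuclideanSpace ℝ (Fin n)) → OnePoint (EuclideanSpace ℝ (Fin n)) → ℝ
  | .some x, .some y => ‖x - y‖ / (√(1 + ‖x‖ ^ 2) * √(1 + ‖y‖ ^ 2))
  | .some x, .infty => 1 / √(1 + ‖x‖ ^ 2)
  | .infty, .some y => 1 / √(1 + ‖y‖ ^ 2)
  | .infty, .infty => 0

/-- The hyperbolic ball in the unit ball, viewed as a subset of `ℝⁿ ∪ {∞}`. -/
noncomputable def hyperbolicBall {n : ℕ} (x : EuclideanSpace ℝ (Fin n)) (r : ℝ) :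
    Set (OnePoint (EuclideanSpace ℝ (Fin n))) :=
  (fun y : EuclideanSpace ℝ (Fin n) => (y : OnePoint (EuclideanSpace ℝ (Fin n)))) ''
    metricBall (unitBall n) hyperbolicDist x r

/-- The chordal ball in `ℝⁿ ∪ {∞}` with a finite centre. -/
noncomputable def chordalBall {n : ℕ} (x : EuclideanSpace ℝ (Fin n)) (r : ℝ) :
    Set (OnePoint (EuclideanSpace ℝ (Fin n))) :=
  metricBall Set.univ chordalDist (x : OnePoint (EuclideanSpace ℝ (Fin n))) r

/-- The radius `m` as a function of `t = |x|` and `r`. -/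
noncomputable def innerRadius (t r : ℝ) : ℝ :=
  (1 - t ^ 2) * Real.sinh (r / 2) /
    (√(1 + t ^ 2) * √((1 + t ^ 2) * Real.cosh r + 2 * t * Real.sinh r))

/-- The radius `M` as a function of `t = |x|` and `r`. -/
noncomputable def outerRadius (t r : ℝ) : ℝ :=
  (1 - t ^ 2) * Real.sinh (r / 2) /
    (√(1 + t ^ 2) * √((1 + t ^ 2) * Real.cosh r - 2 * t * Real.sinh r))

/-! The infimum over curves has the closed form sinh(ρ/2) = |x-y| / (√(1-|x|²) √(1-|y|²)), which is
`ballDist`. Substituting it into the chordal metric gives, for |y| < 1, q(x,y) = (1-|x|²)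
sinh(ρ(x,y)/2) / (√(1+|x|²) √((1-|x|²) cosh ρ(0,y))). For fixed ρ(x,y) only ρ(0,y) varies, and the
triangle inequality keeps it between |ρ(0,x) - ρ(x,y)| and ρ(0,x) + ρ(x,y). Expanding cosh at these
two ends produces exactly the radicands of M and m. Both ends are attained on the line through 0 and
x, whence the sharpness; both radii increase with r, whence the inclusions. Points outside the ball
are never closer to x than m(r), because m(r) stays below the chordal distance from x to the unit
sphere.

The closed form rests on the hyperboloid model, where cosh ρ is the Lorentz product: reversed
Cauchy-Schwarz gives the triangle inequality, and interpolation on the hyperboloid gives geodesics.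
In the arc length parameter, distance from x grows at most at the rate 2/(1-|z|²) on any curve and
at least at that rate on a geodesic, so hyperbolic length dominates `ballDist`, with equality on
geodesics (`hyperbolicDist_eq_ballDist`). -/

/-! ### The closed-form distance and the hyperboloid model. -/

section BallModel

variable {E : Type*} [NormedAddCommGroup E]

/-- The time coordinate of the point of the hyperboloid that corresponds to `x` in the ball. -/
noncomputable def hyperboloidTime (x : E) : ℝ := (1 + ‖x‖ ^ 2) / (1 - ‖x‖ ^ 2)

/-- The closed form of the hyperbolic distance of the unit ball. -/
noncomputable def ballDist (x y : E) : ℝ :=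
  2 * Real.arsinh (‖x - y‖ / (√(1 - ‖x‖ ^ 2) * √(1 - ‖y‖ ^ 2)))

lemma one_sub_norm_sq_pos {x : E} (hx : ‖x‖ < 1) : 0 < 1 - ‖x‖ ^ 2 := by
  nlinarith [norm_nonneg x]

lemma ballDist_comm (x y : E) : ballDist x y = ballDist y x := by
  rw [ballDist, ballDist, norm_sub_rev, mul_comm √(1 - ‖x‖ ^ 2)]

lemma ballDist_self (x : E) : ballDist x x = 0 := by simp [ballDist]

lemma ballDist_nonneg (x y : E) : 0 ≤ ballDist x y := by
  have : 0 ≤ Real.arsinh (‖x - y‖ / (√(1 - ‖x‖ ^ 2) * √(1 - ‖y‖ ^ 2))) :=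
    Real.arsinh_nonneg_iff.2 (by positivity)
  unfold ballDist
  linarith

lemma sinh_half_ballDist (x y : E) :
    Real.sinh (ballDist x y / 2) = ‖x - y‖ / (√(1 - ‖x‖ ^ 2) * √(1 - ‖y‖ ^ 2)) := by
  rw [ballDist, mul_div_cancel_left₀ _ two_ne_zero, Real.sinh_arsinh]

lemma norm_sub_eq_mul_sinh {x y : E} (hx : ‖x‖ < 1) (hy : ‖y‖ < 1) :
    ‖x - y‖ = √(1 - ‖x‖ ^ 2) * √(1 - ‖y‖ ^ 2) * Real.sinh (ballDist x y / 2) := by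
  have h₁ := Real.sqrt_pos.2 (one_sub_norm_sq_pos hx)
  have h₂ := Real.sqrt_pos.2 (one_sub_norm_sq_pos hy)
  rw [sinh_half_ballDist]
  field_simp

lemma sinh_half_ballDist_sq {x y : E} (hx : ‖x‖ < 1) (hy : ‖y‖ < 1) :
    Real.sinh (ballDist x y / 2) ^ 2 = ‖x - y‖ ^ 2 / ((1 - ‖x‖ ^ 2) * (1 - ‖y‖ ^ 2)) := by
  rw [sinh_half_ballDist, div_pow, mul_pow, Real.sq_sqrt (one_sub_norm_sq_pos hx).le,
    Real.sq_sqrt (one_sub_norm_sq_pos hy).le]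

lemma cosh_eq_one_add_two_mul_sinh_half_sq (r : ℝ) :
    Real.cosh r = 1 + 2 * Real.sinh (r / 2) ^ 2 := by
  have h := Real.cosh_two_mul (r / 2)
  rw [mul_div_cancel₀ _ two_ne_zero, Real.cosh_sq] at h
  linarith

lemma eq_ballDist_of_sinh_half_sq {x y : E} (hx : ‖x‖ < 1) (hy : ‖y‖ < 1) {r : ℝ} (hr : 0 ≤ r)
    (h : ‖x - y‖ ^ 2 = (1 - ‖x‖ ^ 2) * (1 - ‖y‖ ^ 2) * Real.sinh (r / 2) ^ 2) :
    ballDist x y = r := by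
  have h₁ := (one_sub_norm_sq_pos hx).ne'
  have h₂ := (one_sub_norm_sq_pos hy).ne'
  have h₃ : Real.sinh (ballDist x y / 2) ^ 2 = Real.sinh (r / 2) ^ 2 := by
    rw [sinh_half_ballDist_sq hx hy, h]
    field_simp
  have h₄ := (pow_left_inj₀ (Real.sinh_nonneg_iff.2 (by linarith [ballDist_nonneg x y]))
    (Real.sinh_nonneg_iff.2 (by linarith)) two_ne_zero).1 h₃
  linarith [Real.sinh_injective h₄]

lemma hyperboloidTime_pos {x : E} (hx : ‖x‖ < 1) : 0 < hyperboloidTime x :=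
  div_pos (by positivity) (one_sub_norm_sq_pos hx)

lemma ballDist_le {x y : E} :
    ballDist x y ≤ 2 * (‖x - y‖ / (√(1 - ‖x‖ ^ 2) * √(1 - ‖y‖ ^ 2))) := by
  rw [← sinh_half_ballDist]
  have := Real.self_le_sinh_iff.2 (div_nonneg (ballDist_nonneg x y) zero_le_two)
  linarith

lemma continuousOn_ballDist (x : E) (hx : ‖x‖ < 1) :
    ContinuousOn (ballDist x) (Metric.ball 0 1) := by
  unfold ballDist
  refine continuousOn_const.mul (Real.continuous_arsinh.comp_continuousOn
    (ContinuousOn.div (by fun_prop) (by fun_prop) fun y hy => ?_))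
  have h₁ := Real.sqrt_pos.2 (one_sub_norm_sq_pos hx)
  have h₂ := Real.sqrt_pos.2 (one_sub_norm_sq_pos (mem_ball_zero_iff.1 hy))
  positivity

variable [InnerProductSpace ℝ E]

/-- The space coordinate of the point of the hyperboloid that corresponds to `x` in the ball. -/
noncomputable def hyperboloidSpace (x : E) : E := (2 / (1 - ‖x‖ ^ 2)) • x

lemma cosh_ballDist {x y : E} (hx : ‖x‖ < 1) (hy : ‖y‖ < 1) :
    Real.cosh (ballDist x y) = hyperboloidTime x * hyperboloidTime y -
      inner ℝ (hyperboloidSpace x) (hyperboloidSpace y) := by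
  have h₁ := (one_sub_norm_sq_pos hx).ne'
  have h₂ := (one_sub_norm_sq_pos hy).ne'
  rw [cosh_eq_one_add_two_mul_sinh_half_sq, sinh_half_ballDist_sq hx hy, hyperboloidTime,
    hyperboloidTime, hyperboloidSpace, hyperboloidSpace, real_inner_smul_left,
    real_inner_smul_right, norm_sub_sq_real]
  field_simp
  ring

lemma norm_hyperboloidSpace_sq {x : E} (hx : ‖x‖ < 1) :
    ‖hyperboloidSpace x‖ ^ 2 = hyperboloidTime x ^ 2 - 1 := by
  have h₁ := (one_sub_norm_sq_pos hx).ne'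
  rw [hyperboloidSpace, hyperboloidTime, norm_smul, mul_pow, Real.norm_eq_abs, sq_abs]
  field_simp
  ring

/-- The reversed Cauchy-Schwarz inequality on the tangent space at `(y₀, y)` of the hyperboloid. -/
lemma lorentz_cauchy_schwarz {x₀ y₀ z₀ : ℝ} {x y z : E} (hy₀ : 0 < y₀)
    (hx : ‖x‖ ^ 2 = x₀ ^ 2 - 1) (hy : ‖y‖ ^ 2 = y₀ ^ 2 - 1) (hz : ‖z‖ ^ 2 = z₀ ^ 2 - 1) :
    ((x₀ * y₀ - inner ℝ x y) * (y₀ * z₀ - inner ℝ y z) - (x₀ * z₀ - inner ℝ x z)) ^ 2 ≤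
      ((x₀ * y₀ - inner ℝ x y) ^ 2 - 1) * ((y₀ * z₀ - inner ℝ y z) ^ 2 - 1) := by
  -- The vector on the left is the space part of (u₀, u) after the Lorentz boost taking (y₀, y) to
  -- (1, 0). Its time part is u₀ y₀ - ⟨u, y⟩, so the identity is invariance of the Lorentz form, and
  -- ordinary Cauchy-Schwarz applies to the space parts.
  have key : ∀ (u₀ v₀ : ℝ) (u v : E),
      inner ℝ (u - (u₀ - inner ℝ u y / (1 + y₀)) • y) (v - (v₀ - inner ℝ v y / (1 + y₀)) • y) =
        (u₀ * y₀ - inner ℝ u y) * (v₀ * y₀ - inner ℝ v y) - (u₀ * v₀ - inner ℝ u v) := by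
    intro u₀ v₀ u v
    have h : 1 + y₀ ≠ 0 := by positivity
    rw [inner_sub_left, inner_sub_right, inner_sub_right, real_inner_smul_left,
      real_inner_smul_right, real_inner_smul_left, real_inner_smul_right,
      real_inner_self_eq_norm_sq, hy, real_inner_comm v y]
    field_simp
    ring
  have h := real_inner_mul_inner_self_le (x - (x₀ - inner ℝ x y / (1 + y₀)) • y)
    (z - (z₀ - inner ℝ z y / (1 + y₀)) • y)
  rw [key, key, key, real_inner_self_eq_norm_sq, real_inner_self_eq_norm_sq, hx, hz,
    real_inner_comm y z] at h
  nlinarith [h]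

/-- Reversed Cauchy-Schwarz bounds cosh d(x,z) by the addition formula for cosh (d(x,y) + d(y,z)).
-/
lemma ballDist_triangle {x y z : E} (hx : ‖x‖ < 1) (hy : ‖y‖ < 1) (hz : ‖z‖ < 1) :
    ballDist x z ≤ ballDist x y + ballDist y z := by
  have h := lorentz_cauchy_schwarz (hyperboloidTime_pos hy) (norm_hyperboloidSpace_sq hx)
    (norm_hyperboloidSpace_sq hy) (norm_hyperboloidSpace_sq hz)
  rw [← cosh_ballDist hx hy, ← cosh_ballDist hy hz, ← cosh_ballDist hx hz, ← Real.sinh_sq,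
    ← Real.sinh_sq, ← mul_pow] at h
  have h₁ := Real.sinh_nonneg_iff.2 (ballDist_nonneg x y)
  have h₂ := Real.sinh_nonneg_iff.2 (ballDist_nonneg y z)
  have h₃ := neg_le_of_abs_le (abs_le_of_sq_le_sq h (mul_nonneg h₁ h₂))
  have h₄ : Real.cosh (ballDist x z) ≤ Real.cosh (ballDist x y + ballDist y z) := by
    rw [Real.cosh_add]
    linarith
  have h₅ := Real.cosh_le_cosh.1 h₄
  rwa [abs_of_nonneg (ballDist_nonneg x z),
    abs_of_nonneg (add_nonneg (ballDist_nonneg x y) (ballDist_nonneg y z))] at h₅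

/-- The point of the ball that corresponds to a point of the hyperboloid. -/
lemma exists_of_mem_hyperboloid {v₀ : ℝ} {v : E} (hv₀ : 0 < v₀) (hv : ‖v‖ ^ 2 = v₀ ^ 2 - 1) :
    ‖(1 + v₀)⁻¹ • v‖ < 1 ∧ hyperboloidTime ((1 + v₀)⁻¹ • v) = v₀ ∧
      hyperboloidSpace ((1 + v₀)⁻¹ • v) = v := by
  have h : 1 + v₀ ≠ 0 := by positivity
  have hn : ‖(1 + v₀)⁻¹ • v‖ ^ 2 = (v₀ - 1) / (1 + v₀) := by
    rw [norm_smul, mul_pow, Real.norm_eq_abs, sq_abs, hv]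
    field_simp
    ring
  have hn' : 1 - (v₀ - 1) / (1 + v₀) = 2 / (1 + v₀) := by field_simp; ring
  refine ⟨?_, ?_, ?_⟩
  · have : 0 < 2 / (1 + v₀) := by positivity
    exact (sq_lt_one_iff₀ (norm_nonneg _)).1 (by rw [hn]; linarith)
  · rw [hyperboloidTime, hn, hn']
    field_simp
    ring
  · rw [hyperboloidSpace, hn, hn', smul_smul]
    field_simp
    simp

lemma smul_hyperboloidSpace {x : E} (hx : ‖x‖ < 1) :
    (1 + hyperboloidTime x)⁻¹ • hyperboloidSpace x = x := by
  have h₁ := (one_sub_norm_sq_pos hx).ne'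
  have h : 1 + hyperboloidTime x = 2 / (1 - ‖x‖ ^ 2) := by
    rw [hyperboloidTime]
    field_simp
    ring
  rw [h, hyperboloidSpace, smul_smul, inv_mul_cancel₀ (by positivity), one_smul]

/-- Two points of the ball are joined by a geodesic. -/
lemma exists_ballDist_geodesic {x y : E} (hx : ‖x‖ < 1) (hy : ‖y‖ < 1) :
    ∃ γ : ℝ → E, γ 0 = x ∧ γ (ballDist x y) = y ∧ (∀ t ∈ Icc 0 (ballDist x y), ‖γ t‖ < 1) ∧
      ∀ s ∈ Icc 0 (ballDist x y), ∀ t ∈ Icc 0 (ballDist x y), ballDist (γ s) (γ t) = |s - t| := by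
  have hC := cosh_ballDist hx hy
  rcases (ballDist_nonneg x y).eq_or_lt with h0 | h0
  · have hxy : x = y := by
      have := norm_sub_eq_mul_sinh hx hy
      rwa [← h0, zero_div, Real.sinh_zero, mul_zero, norm_eq_zero, sub_eq_zero] at this
    refine ⟨fun _ => x, rfl, hxy, fun _ _ => hx, fun s hs t ht => ?_⟩
    rw [← h0, Icc_self, mem_singleton_iff] at hs ht
    rw [hs, ht, sub_self, abs_zero, ballDist_self]
  set d := ballDist x y
  have hd : 0 < Real.sinh d := Real.sinh_pos_iff.2 h0
  set a := hyperboloidTime x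
  set b := hyperboloidTime y
  set u := hyperboloidSpace x
  set w := hyperboloidSpace y
  have ha : ‖u‖ ^ 2 = a ^ 2 - 1 := norm_hyperboloidSpace_sq hx
  have hb : ‖w‖ ^ 2 = b ^ 2 - 1 := norm_hyperboloidSpace_sq hy
  -- Hyperbolic analogue of spherical linear interpolation between (a, u) and (b, w); division by
  -- sinh d is why d = 0 was treated apart.
  let v₀ : ℝ → ℝ := fun t => Real.sinh (d - t) / Real.sinh d * a + Real.sinh t / Real.sinh d * b
  let v : ℝ → E := fun t =>
    (Real.sinh (d - t) / Real.sinh d) • u + (Real.sinh t / Real.sinh d) • w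
  have hB : ∀ s t, v₀ s * v₀ t - inner ℝ (v s) (v t) = Real.cosh (s - t) := by
    intro s t
    simp only [v₀, v]
    rw [inner_add_left, inner_add_right, inner_add_right]
    simp only [real_inner_smul_left, real_inner_smul_right, real_inner_self_eq_norm_sq, ha, hb]
    rw [real_inner_comm u w, show inner ℝ u w = a * b - Real.cosh d by linarith, Real.sinh_sub,
      Real.sinh_sub, Real.cosh_sub]
    field_simp
    linear_combination (-Real.sinh s * Real.sinh t) * Real.cosh_sq d
  have hv : ∀ t, ‖v t‖ ^ 2 = v₀ t ^ 2 - 1 := by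
    intro t
    have := hB t t
    rw [sub_self, Real.cosh_zero, real_inner_self_eq_norm_sq] at this
    linarith
  have hv₀ : ∀ t ∈ Icc 0 d, 0 < v₀ t := by
    intro t ht
    have h₁ : 0 ≤ v₀ t := by
      have := Real.sinh_nonneg_iff.2 ht.1
      have := Real.sinh_nonneg_iff.2 (sub_nonneg.2 ht.2)
      have : 0 < a := hyperboloidTime_pos hx
      have : 0 < b := hyperboloidTime_pos hy
      positivity
    nlinarith [hv t, sq_nonneg ‖v t‖]
  refine ⟨fun t => (1 + v₀ t)⁻¹ • v t, ?_, ?_,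
    fun t ht => (exists_of_mem_hyperboloid (hv₀ t ht) (hv t)).1, fun s hs t ht => ?_⟩
  · have h₁ : v₀ 0 = a := by simp [v₀, hd.ne']
    have h₂ : v 0 = u := by simp [v, hd.ne']
    simp only [h₁, h₂]
    exact smul_hyperboloidSpace hx
  · have h₁ : v₀ d = b := by simp [v₀, hd.ne']
    have h₂ : v d = w := by simp [v, hd.ne']
    simp only [h₁, h₂]
    exact smul_hyperboloidSpace hy
  · obtain ⟨h₁, h₂, h₃⟩ := exists_of_mem_hyperboloid (hv₀ s hs) (hv s)
    obtain ⟨h₄, h₅, h₆⟩ := exists_of_mem_hyperboloid (hv₀ t ht) (hv t)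
    have h := cosh_ballDist h₁ h₄
    rw [h₂, h₃, h₅, h₆, hB, ← Real.cosh_abs (s - t)] at h
    have h' := le_antisymm (Real.cosh_le_cosh.1 h.le) (Real.cosh_le_cosh.1 h.ge)
    rwa [abs_of_nonneg (ballDist_nonneg _ _), abs_abs] at h'

end BallModel

/-! ### Arc length parametrization of continuous curves. -/

section Variation

variable {E : Type*} [MetricSpace E] {γ : ℝ → E} {a b : ℝ}

/-- The one-sided jumps of the variation function are those of γ, hence zero. -/
lemma ContinuousOn.variationOnFromTo (hc : ContinuousOn γ (Icc a b))
    (hv : BoundedVariationOn γ (Icc a b)) (hab : a ≤ b) :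
    ContinuousOn (variationOnFromTo γ (Icc a b) a) (Icc a b) := by
  intro t ht
  have hl := hv.locallyBoundedVariationOn
  have ha := left_mem_Icc.2 hab
  have h₁ := variationOnFromTo.tendsto_left ha ht hl ((hc t ht).mono inter_subset_left)
  have h₂ := variationOnFromTo.tendsto_right ha ht hl ((hc t ht).mono inter_subset_left)
  rw [dist_self, sub_zero] at h₁
  rw [dist_self, add_zero] at h₂
  rw [← continuousWithinAt_sdiff_self, show Icc a b \ {t} = (Icc a b ∩ Iio t) ∪ (Icc a b ∩ Ioi t) by
    rw [← inter_union_distrib_left, Iio_union_Ioi]; rfl]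
  exact ContinuousWithinAt.union h₁ h₂

lemma variationOnFromTo_Icc (hab : a ≤ b) :
    variationOnFromTo γ (Icc a b) a b = (eVariationOn γ (Icc a b)).toReal := by
  rw [variationOnFromTo.eq_of_le _ _ hab, inter_self]

/-- Continuity leaves no gaps in the arc length parameter, so unit speed of the natural
parametrization holds on the whole of [0, L]. -/
lemma image_variationOnFromTo (hc : ContinuousOn γ (Icc a b))
    (hv : BoundedVariationOn γ (Icc a b)) (hab : a ≤ b) :
    variationOnFromTo γ (Icc a b) a '' Icc a b = Icc 0 (eVariationOn γ (Icc a b)).toReal := by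
  have hm := variationOnFromTo.monotoneOn hv.locallyBoundedVariationOn (left_mem_Icc.2 hab)
  rw [(hc.variationOnFromTo hv hab).image_Icc hab,
    hm.sInf_image_Icc hab, hm.sSup_image_Icc hab, variationOnFromTo.self, variationOnFromTo_Icc hab]

lemma naturalParameterization_variationOnFromTo (hv : BoundedVariationOn γ (Icc a b))
    {t : ℝ} (ht : t ∈ Icc a b) :
    naturalParameterization γ (Icc a b) a (variationOnFromTo γ (Icc a b) a t) = γ t :=
  edist_eq_zero.1 (edist_naturalParameterization_eq_zero hv.locallyBoundedVariationOn
    (left_mem_Icc.2 (ht.1.trans ht.2)) ht)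

lemma dist_naturalParameterization_le (hc : ContinuousOn γ (Icc a b))
    (hv : BoundedVariationOn γ (Icc a b)) (hab : a ≤ b) {s t : ℝ}
    (hs : s ∈ Icc 0 (eVariationOn γ (Icc a b)).toReal)
    (ht : t ∈ Icc 0 (eVariationOn γ (Icc a b)).toReal) :
    dist (naturalParameterization γ (Icc a b) a s) (naturalParameterization γ (Icc a b) a t) ≤
      |s - t| := by
  wlog hst : s ≤ t generalizing s t
  · rw [dist_comm, abs_sub_comm]
    exact this ht hs (le_of_not_ge hst)
  have h := has_unit_speed_naturalParameterization γ hv.locallyBoundedVariationOn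
    (left_mem_Icc.2 hab)
  rw [image_variationOnFromTo hc hv hab] at h
  have h₁ := eVariationOn.edist_le (naturalParameterization γ (Icc a b) a)
    (s := Icc 0 (eVariationOn γ (Icc a b)).toReal ∩ Icc s t) ⟨hs, left_mem_Icc.2 hst⟩
    ⟨ht, right_mem_Icc.2 hst⟩
  rw [h hs ht, edist_dist, ENNReal.ofReal_le_ofReal_iff (by simpa using hst)] at h₁
  rw [abs_sub_comm, abs_of_nonneg (sub_nonneg.2 hst)]
  simpa using h₁

end Variation

/-- A function whose right slopes are bounded by a continuous function grows by at most the
integral of this function. -/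
lemma sub_le_integral_of_frequently_slope_lt {f w : ℝ → ℝ} {L : ℝ} (hL : 0 ≤ L)
    (hf : ContinuousOn f (Icc 0 L)) (hw : ContinuousOn w (Icc 0 L))
    (bound : ∀ x ∈ Ico 0 L, ∀ r, w x < r → ∃ᶠ z in 𝓝[>] x, slope f x z < r) :
    f L - f 0 ≤ ∫ s in (0 : ℝ)..L, w s := by
  -- Extending w continuously to ℝ makes its integral differentiable at every point, endpoints
  -- included.
  have hcont : Continuous (IccExtend hL ((Icc 0 L).domRestrict w)) :=
    (continuousOn_iff_continuous_domRestrict.1 hw).Icc_extend'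
  have heq : ∀ x ∈ Icc 0 L, IccExtend hL ((Icc 0 L).domRestrict w) x = w x := fun x hx => by
    rw [IccExtend_of_mem hL _ hx]; rfl
  have hderiv : ∀ x, HasDerivAt
      (fun x => f 0 + ∫ s in (0 : ℝ)..x, IccExtend hL ((Icc 0 L).domRestrict w) s)
      (IccExtend hL ((Icc 0 L).domRestrict w) x) x := fun x =>
    (intervalIntegral.integral_hasDerivAt_right (hcont.intervalIntegrable _ _)
      (hcont.stronglyMeasurableAtFilter _ _) hcont.continuousAt).const_add _
  have h := image_le_of_liminf_slope_right_le_deriv_boundary hf (by simp)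
    (fun x _ => (hderiv x).continuousAt.continuousWithinAt)
    (fun x _ => (hderiv x).hasDerivWithinAt)
    (fun x hx r hr => bound x hx r (by rwa [heq x (Ico_subset_Icc_self hx)] at hr))
    (right_mem_Icc.2 hL)
  rw [intervalIntegral.integral_congr (g := w) fun x hx => heq x (by rwa [uIcc_of_le hL] at hx)] at h
  linarith

/-! ### Hyperbolic length is at least the closed-form distance. -/

section Curves

variable {n : ℕ} {x y : EuclideanSpace ℝ (Fin n)} {γ : ℝ → EuclideanSpace ℝ (Fin n)} {a b : ℝ}

lemma IsRectifiableCurve.naturalParameterization_mem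
    {G : Set (EuclideanSpace ℝ (Fin n))} (h : IsRectifiableCurve G x y γ a b) {s : ℝ}
    (hs : s ∈ Icc 0 (eVariationOn γ (Icc a b)).toReal) :
    naturalParameterization γ (Icc a b) a s ∈ G := by
  rw [← image_variationOnFromTo h.continuousOn h.boundedVariationOn h.le] at hs
  obtain ⟨t, ht, rfl⟩ := hs
  rw [naturalParameterization_variationOnFromTo h.boundedVariationOn ht]
  exact h.mapsTo ht

lemma IsRectifiableCurve.continuousOn_naturalParameterization
    {G : Set (EuclideanSpace ℝ (Fin n))} (h : IsRectifiableCurve G x y γ a b) :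
    ContinuousOn (naturalParameterization γ (Icc a b) a)
      (Icc 0 (eVariationOn γ (Icc a b)).toReal) := by
  refine LipschitzOnWith.continuousOn (K := 1) (LipschitzOnWith.of_dist_le_mul fun s hs t ht => ?_)
  rw [NNReal.coe_one, one_mul, Real.dist_eq]
  exact dist_naturalParameterization_le h.continuousOn h.boundedVariationOn h.le hs ht

lemma IsRectifiableCurve.naturalParameterization_zero
    {G : Set (EuclideanSpace ℝ (Fin n))} (h : IsRectifiableCurve G x y γ a b) :
    naturalParameterization γ (Icc a b) a 0 = x := by
  have := naturalParameterization_variationOnFromTo h.boundedVariationOn (left_mem_Icc.2 h.le)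
  rwa [variationOnFromTo.self, h.source] at this

lemma IsRectifiableCurve.naturalParameterization_length
    {G : Set (EuclideanSpace ℝ (Fin n))} (h : IsRectifiableCurve G x y γ a b) :
    naturalParameterization γ (Icc a b) a (eVariationOn γ (Icc a b)).toReal = y := by
  have := naturalParameterization_variationOnFromTo h.boundedVariationOn (right_mem_Icc.2 h.le)
  rwa [variationOnFromTo_Icc h.le, h.target] at this

lemma mem_unitBall {z : EuclideanSpace ℝ (Fin n)} : z ∈ unitBall n ↔ ‖z‖ < 1 :=
  mem_ball_zero_iff

lemma continuousOn_hyperbolicDensity :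
    ContinuousOn (fun z : EuclideanSpace ℝ (Fin n) => 2 / (1 - ‖z‖ ^ 2)) (unitBall n) :=
  ContinuousOn.div (by fun_prop) (by fun_prop) fun _ hz =>
    (one_sub_norm_sq_pos (mem_unitBall.1 hz)).ne'

/-- By the triangle inequality, the slope of d(x, g) between s and z is at most d(g s, g z)/(z - s).
As g is 1-Lipschitz, this has a bound tending to the density at g s; no derivative of g is needed.
-/
lemma ballDist_le_hyperbolicLength (hx : ‖x‖ < 1) (h : IsRectifiableCurve (unitBall n) x y γ a b) :
    ballDist x y ≤ hyperbolicLength γ a b := by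
  set L := (eVariationOn γ (Icc a b)).toReal with hL
  set g := naturalParameterization γ (Icc a b) a with hg
  have hg0 : g 0 = x := h.naturalParameterization_zero
  have hgL : g L = y := h.naturalParameterization_length
  have hgc : ContinuousOn g (Icc 0 L) := h.continuousOn_naturalParameterization
  have hgm : MapsTo g (Icc 0 L) (unitBall n) := fun s => h.naturalParameterization_mem
  have hgb : ∀ s ∈ Icc 0 L, ‖g s‖ < 1 := fun s hs => mem_unitBall.1 (hgm hs)
  have key := sub_le_integral_of_frequently_slope_lt (L := L) (f := fun s => ballDist x (g s))
    (w := fun s => 2 / (1 - ‖g s‖ ^ 2)) ENNReal.toReal_nonneg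
    ((continuousOn_ballDist x hx).comp hgc hgm) (continuousOn_hyperbolicDensity.comp hgc hgm) ?_
  · simp only [hg0, hgL, ballDist_self, sub_zero] at key
    exact key
  intro s hs r hr
  have hs' := Ico_subset_Icc_self hs
  have hmem : Icc 0 L ∈ 𝓝[>] s := mem_of_superset (Ioo_mem_nhdsGT hs.2) fun z hz =>
    ⟨hs.1.trans hz.1.le, hz.2.le⟩
  have hpos := one_sub_norm_sq_pos (hgb s hs')
  have hlim : Tendsto (fun z => 2 / (√(1 - ‖g s‖ ^ 2) * √(1 - ‖g z‖ ^ 2))) (𝓝[>] s)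
      (𝓝 (2 / (1 - ‖g s‖ ^ 2))) := by
    have h₁ : Tendsto g (𝓝[>] s) (𝓝 (g s)) :=
      (hgc s hs').mono_left (nhdsWithin_le_iff.2 hmem)
    have h₂ := ((h₁.norm.pow 2).const_sub 1).sqrt.const_mul √(1 - ‖g s‖ ^ 2)
    rw [Real.mul_self_sqrt hpos.le] at h₂
    exact tendsto_const_nhds.div h₂ hpos.ne'
  refine Eventually.frequently ?_
  filter_upwards [hlim.eventually (gt_mem_nhds hr), hmem, self_mem_nhdsWithin] with z hz hz' hsz
  have hsz : 0 < z - s := sub_pos.2 hsz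
  refine lt_of_le_of_lt ?_ hz
  rw [slope_def_field, div_le_iff₀ hsz]
  have h₁ := ballDist_triangle hx (hgb s hs') (hgb z hz')
  have h₂ : ‖g s - g z‖ ≤ z - s := by
    rw [← dist_eq_norm, ← abs_of_pos hsz, abs_sub_comm]
    exact dist_naturalParameterization_le h.continuousOn h.boundedVariationOn h.le hs' hz'
  calc ballDist x (g z) - ballDist x (g s) ≤ ballDist (g s) (g z) := by linarith
    _ ≤ 2 * (‖g s - g z‖ / (√(1 - ‖g s‖ ^ 2) * √(1 - ‖g z‖ ^ 2))) := ballDist_le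
    _ ≤ 2 * ((z - s) / (√(1 - ‖g s‖ ^ 2) * √(1 - ‖g z‖ ^ 2))) := by gcongr
    _ = _ := by ring

end Curves

lemma sinh_le_mul_cosh {u : ℝ} (hu : 0 ≤ u) : Real.sinh u ≤ u * Real.cosh u := by
  rcases hu.eq_or_lt with rfl | hu
  · simp
  obtain ⟨c, hc, h⟩ := exists_deriv_eq_slope Real.sinh hu Real.continuous_sinh.continuousOn
    Real.differentiable_sinh.differentiableOn
  rw [Real.deriv_sinh, Real.sinh_zero, sub_zero, sub_zero, eq_div_iff hu.ne'] at h
  have : Real.cosh c ≤ Real.cosh u :=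
    Real.cosh_le_cosh.2 (by rw [abs_of_pos hc.1, abs_of_pos hu]; exact hc.2.le)
  nlinarith

/-! ### Euclidean length of curves parametrized by hyperbolic distance. -/

section Geodesics

variable {E : Type*} [NormedAddCommGroup E] {γ : ℝ → E} {T : ℝ}

/-- Euclidean speed is the reciprocal of the density: A bounds that reciprocal, and the error factor
cosh (δ/2) tends to 1 on short intervals. -/
lemma norm_sub_le_mul_of_ballDist_eq (hmem : ∀ t ∈ Icc 0 T, ‖γ t‖ < 1)
    (hiso : ∀ s ∈ Icc 0 T, ∀ t ∈ Icc 0 T, ballDist (γ s) (γ t) = |s - t|) {A δ u v : ℝ}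
    (hu : u ∈ Icc 0 T) (hv : v ∈ Icc 0 T) (hA : 0 ≤ A) (hAu : (1 - ‖γ u‖ ^ 2) / 2 ≤ A)
    (hAv : (1 - ‖γ v‖ ^ 2) / 2 ≤ A) (hδ : |u - v| ≤ δ) :
    ‖γ u - γ v‖ ≤ A * Real.cosh (δ / 2) * |u - v| := by
  have h₁ : √(1 - ‖γ u‖ ^ 2) * √(1 - ‖γ v‖ ^ 2) ≤ 2 * A :=
    calc _ ≤ √(2 * A) * √(2 * A) := by gcongr <;> linarith
      _ = 2 * A := Real.mul_self_sqrt (by positivity)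
  have h₂ : Real.sinh (|u - v| / 2) ≤ |u - v| / 2 * Real.cosh (δ / 2) := by
    refine (sinh_le_mul_cosh (by positivity)).trans ?_
    refine mul_le_mul_of_nonneg_left ?_ (by positivity)
    exact Real.cosh_le_cosh.2 (abs_le_abs_of_nonneg (by positivity) (by linarith))
  have h₃ : 0 ≤ Real.sinh (|u - v| / 2) := Real.sinh_nonneg_iff.2 (by positivity)
  rw [norm_sub_eq_mul_sinh (hmem u hu) (hmem v hv), hiso u hu v hv]
  calc _ ≤ 2 * A * (|u - v| / 2 * Real.cosh (δ / 2)) := by gcongr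
    _ = _ := by ring

/-- A crude global constant, enough for continuity and rectifiability. -/
lemma lipschitzOnWith_of_ballDist_eq (hmem : ∀ t ∈ Icc 0 T, ‖γ t‖ < 1)
    (hiso : ∀ s ∈ Icc 0 T, ∀ t ∈ Icc 0 T, ballDist (γ s) (γ t) = |s - t|) :
    LipschitzOnWith (Real.toNNReal (1 * Real.cosh (T / 2))) γ (Icc 0 T) := by
  refine LipschitzOnWith.of_dist_le_mul fun u hu v hv => ?_
  rw [Real.coe_toNNReal _ (by positivity), dist_eq_norm, Real.dist_eq]
  refine norm_sub_le_mul_of_ballDist_eq hmem hiso hu hv zero_le_one ?_ ?_ ?_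
  · linarith [sq_nonneg ‖γ u‖]
  · linarith [sq_nonneg ‖γ v‖]
  · rw [abs_le]
    constructor <;> linarith [hu.1, hu.2, hv.1, hv.2]

lemma LipschitzOnWith.eVariationOn_Icc_le {C : NNReal} {a b : ℝ}
    (h : LipschitzOnWith C γ (Icc a b)) :
    eVariationOn γ (Icc a b) ≤ C * ENNReal.ofReal (b - a) := by
  have := h.comp_eVariationOn_le (mapsTo_id _)
  rwa [eVariationOn_id_Icc] at this

lemma eventually_eVariationOn_le_of_ballDist_eq (hmem : ∀ t ∈ Icc 0 T, ‖γ t‖ < 1)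
    (hiso : ∀ s ∈ Icc 0 T, ∀ t ∈ Icc 0 T, ballDist (γ s) (γ t) = |s - t|) {t c : ℝ}
    (ht : t ∈ Ico 0 T) (hc : (1 - ‖γ t‖ ^ 2) / 2 < c) :
    ∀ᶠ z in 𝓝[>] t, eVariationOn γ (Icc t z) ≤ ENNReal.ofReal (c * (z - t)) := by
  have ht' := Ico_subset_Icc_self ht
  have hpos := one_sub_norm_sq_pos (hmem t ht')
  -- The gap between A and c absorbs the factor cosh ((z - t)/2).
  obtain ⟨A, hA, hAc⟩ := exists_between hc
  have hA0 : 0 < A := by linarith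
  have hcont : Tendsto (fun u => (1 - ‖γ u‖ ^ 2) / 2) (𝓝[≥] t) (𝓝 ((1 - ‖γ t‖ ^ 2) / 2)) := by
    have h₁ : Tendsto γ (𝓝[≥] t) (𝓝 (γ t)) :=
      ((lipschitzOnWith_of_ballDist_eq hmem hiso).continuousOn t ht').mono_left
        (nhdsWithin_le_iff.2 (mem_of_superset (Ico_mem_nhdsGE ht.2) fun z hz =>
          ⟨ht.1.trans hz.1, hz.2.le⟩))
    exact ((h₁.norm.pow 2).const_sub 1).div_const 2
  obtain ⟨e, he, hsub⟩ := (mem_nhdsGE_iff_exists_Ico_subset' ht.2).1 (hcont.eventually (gt_mem_nhds hA))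
  have hcosh : Tendsto (fun z => A * Real.cosh ((z - t) / 2)) (𝓝[>] t) (𝓝 A) := by
    have : Continuous fun z => A * Real.cosh ((z - t) / 2) := by fun_prop
    simpa using (this.tendsto t).mono_left nhdsWithin_le_nhds
  filter_upwards [hcosh.eventually (gt_mem_nhds hAc), Ioo_mem_nhdsGT he, Ioo_mem_nhdsGT ht.2]
    with z hz hze hzT
  have hin : ∀ u ∈ Icc t z, u ∈ Icc 0 T ∧ (1 - ‖γ u‖ ^ 2) / 2 ≤ A := fun u hu =>
    ⟨⟨ht.1.trans hu.1, hu.2.trans hzT.2.le⟩, (hsub ⟨hu.1, hu.2.trans_lt hze.2⟩).le⟩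
  have hlip : LipschitzOnWith (Real.toNNReal c) γ (Icc t z) := by
    refine LipschitzOnWith.of_dist_le_mul fun u hu v hv => ?_
    rw [Real.coe_toNNReal _ (by linarith), dist_eq_norm, Real.dist_eq]
    refine (norm_sub_le_mul_of_ballDist_eq hmem hiso (hin u hu).1 (hin v hv).1 hA0.le (hin u hu).2
      (hin v hv).2 (δ := z - t) ?_).trans (by gcongr)
    rw [abs_le]
    constructor <;> linarith [hu.1, hu.2, hv.1, hv.2]
  refine hlip.eVariationOn_Icc_le.trans_eq ?_
  rw [ENNReal.ofReal_mul (by linarith)]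
  rfl

end Geodesics

/-! ### The infimum is attained by geodesics. -/

section HyperbolicMetric

variable {n : ℕ} {x y : EuclideanSpace ℝ (Fin n)}

lemma exists_hyperbolicLength_le_ballDist (hx : ‖x‖ < 1) (hy : ‖y‖ < 1) :
    ∃ (γ : ℝ → EuclideanSpace ℝ (Fin n)) (a b : ℝ),
      IsRectifiableCurve (unitBall n) x y γ a b ∧ hyperbolicLength γ a b ≤ ballDist x y := by
  obtain ⟨γ, h0, h1, hmem, hiso⟩ := exists_ballDist_geodesic hx hy
  set T := ballDist x y with hT
  have hT0 : 0 ≤ T := ballDist_nonneg x y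
  have hlip := lipschitzOnWith_of_ballDist_eq hmem hiso
  have hv : BoundedVariationOn γ (Icc 0 T) :=
    ne_top_of_le_ne_top (by finiteness) hlip.eVariationOn_Icc_le
  have h : IsRectifiableCurve (unitBall n) x y γ 0 T :=
    ⟨hT0, hlip.continuousOn, hv, fun t ht => mem_unitBall.2 (hmem t ht), h0, h1⟩
  refine ⟨γ, 0, T, h, ?_⟩
  set L := (eVariationOn γ (Icc 0 T)).toReal with hL
  set g := naturalParameterization γ (Icc 0 T) 0 with hg
  set ℓ := variationOnFromTo γ (Icc 0 T) 0 with hℓ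
  have hg0 : g 0 = x := h.naturalParameterization_zero
  have hgL : g L = y := h.naturalParameterization_length
  have hgℓ : ∀ t ∈ Icc 0 T, g (ℓ t) = γ t := fun t ht =>
    naturalParameterization_variationOnFromTo hv ht
  have hgc : ContinuousOn g (Icc 0 L) := h.continuousOn_naturalParameterization
  have hgm : MapsTo g (Icc 0 L) (unitBall n) := fun s => h.naturalParameterization_mem
  -- Negation turns the comparison into an upper bound for the integral of the density.
  have key := sub_le_integral_of_frequently_slope_lt (L := L) (f := fun s => -ballDist x (g s))
    (w := fun s => -(2 / (1 - ‖g s‖ ^ 2))) ENNReal.toReal_nonneg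
    ((continuousOn_ballDist x hx).comp hgc hgm).neg
    (continuousOn_hyperbolicDensity.comp hgc hgm).neg ?_
  · simp only [hg0, hgL, ballDist_self, intervalIntegral.integral_neg] at key
    have : hyperbolicLength γ 0 T = ∫ s in (0 : ℝ)..L, 2 / (1 - ‖g s‖ ^ 2) := rfl
    linarith
  intro s hs r hr
  have hs' := Ico_subset_Icc_self hs
  rw [hL, ← image_variationOnFromTo hlip.continuousOn hv hT0] at hs'
  obtain ⟨t, ht, rfl⟩ := hs'
  change ℓ t ∈ _ at hs
  change -(2 / (1 - ‖g (ℓ t)‖ ^ 2)) < r at hr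
  change ∃ᶠ z in 𝓝[>] (ℓ t), _
  rw [hgℓ t ht] at hr
  have htT : t ∈ Ico 0 T := by
    refine ⟨ht.1, lt_of_le_of_ne ht.2 ?_⟩
    rintro rfl
    exact hs.2.ne (variationOnFromTo_Icc hT0)
  have hpos := one_sub_norm_sq_pos (hmem t ht)
  -- c is slightly above the Euclidean speed at t, so that 1/c, a lower bound for the slope of the
  -- distance in arc length, still beats -r.
  obtain ⟨c, hcr, hc⟩ : ∃ c, -c⁻¹ < r ∧ (1 - ‖γ t‖ ^ 2) / 2 < c := by
    have hlim : Tendsto (fun c : ℝ => -c⁻¹) (𝓝[>] ((1 - ‖γ t‖ ^ 2) / 2))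
        (𝓝 (-(2 / (1 - ‖γ t‖ ^ 2)))) := by
      rw [← inv_div (1 - ‖γ t‖ ^ 2)]
      exact ((tendsto_inv₀ (half_pos hpos).ne').mono_left nhdsWithin_le_nhds).neg
    exact ((hlim.eventually (gt_mem_nhds hr)).and self_mem_nhdsWithin).exists
  have hmem' : Icc 0 T ∈ 𝓝[>] t := mem_of_superset (Ioo_mem_nhdsGT htT.2) fun z hz =>
    ⟨ht.1.trans hz.1.le, hz.2.le⟩
  -- Zero variation on [t, z] would force γ t = γ z, against the isometry property.
  have hmono : ∀ z ∈ Icc 0 T, t < z → ℓ t < ℓ z := by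
    intro z hz htz
    have hl := hv.locallyBoundedVariationOn
    have h0T := left_mem_Icc.2 hT0
    refine lt_of_le_of_ne (variationOnFromTo.monotoneOn hl h0T ht hz htz.le) fun heq => ?_
    have := edist_eq_zero.1 (variationOnFromTo.edist_zero_of_eq_zero hl ht hz
      ((variationOnFromTo.eq_left_iff hl h0T ht hz).1 heq))
    have h2 := hiso t ht z hz
    rw [this, ballDist_self, eq_comm, abs_eq_zero] at h2
    linarith
  have hℓt : Tendsto ℓ (𝓝[>] t) (𝓝[>] (ℓ t)) := by
    refine tendsto_nhdsWithin_iff.2 ⟨?_, ?_⟩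
    · exact (hlip.continuousOn.variationOnFromTo hv hT0 t ht).mono_left (nhdsWithin_le_iff.2 hmem')
    · filter_upwards [hmem', self_mem_nhdsWithin] with z hz htz using hmono z hz htz
  -- It suffices to test slopes at the arc length values ℓ z, where the distance from x is just z.
  refine hℓt.frequently (Eventually.frequently ?_)
  filter_upwards [hmem', self_mem_nhdsWithin,
    eventually_eVariationOn_le_of_ballDist_eq hmem hiso htT hc] with z hz htz hle
  have htz : t < z := htz
  have hc0 : 0 < c := by linarith
  have hdist : ∀ u ∈ Icc 0 T, ballDist x (g (ℓ u)) = u := fun u hu => by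
    rw [hgℓ u hu, ← h0, hiso 0 (left_mem_Icc.2 hT0) u hu, zero_sub, abs_neg, abs_of_nonneg hu.1]
  have hsub : ℓ z - ℓ t ≤ c * (z - t) := by
    rw [hℓ, variationOnFromTo.sub_right hv.locallyBoundedVariationOn (left_mem_Icc.2 hT0) hz ht,
      variationOnFromTo.eq_of_le _ _ htz.le]
    refine ENNReal.toReal_le_of_le_ofReal (mul_nonneg hc0.le (by linarith)) ?_
    exact (eVariationOn.mono _ inter_subset_right).trans hle
  have hlt := sub_pos.2 (hmono z hz htz)
  refine lt_of_le_of_lt ?_ hcr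
  rw [slope_def_field, hdist z hz, hdist t ht, div_le_iff₀ hlt]
  have : c⁻¹ * (ℓ z - ℓ t) ≤ z - t := by
    rw [inv_mul_le_iff₀ hc0]
    exact hsub
  linarith

theorem hyperbolicDist_eq_ballDist (hx : ‖x‖ < 1) (hy : ‖y‖ < 1) :
    hyperbolicDist x y = ballDist x y := by
  have hlb : ∀ l ∈ {l : ℝ | ∃ (γ : ℝ → EuclideanSpace ℝ (Fin n)) (a b : ℝ),
      IsRectifiableCurve (unitBall n) x y γ a b ∧ l = hyperbolicLength γ a b},
      ballDist x y ≤ l := by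
    rintro l ⟨γ, a, b, h, rfl⟩
    exact ballDist_le_hyperbolicLength hx h
  obtain ⟨γ, a, b, h, hle⟩ := exists_hyperbolicLength_le_ballDist hx hy
  exact le_antisymm ((csInf_le ⟨_, hlb⟩ ⟨γ, a, b, h, rfl⟩).trans hle)
    (le_csInf ⟨_, γ, a, b, h, rfl⟩ hlb)

end HyperbolicMetric

/-! ### Monotonicity and asymptotics of the radii. -/

section Radii

variable {t r : ℝ}

/-- Allowing t of either sign in the lemmas on m lets them serve M as well. -/
lemma outerRadius_eq_innerRadius_neg (t r : ℝ) : outerRadius t r = innerRadius (-t) r := by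
  simp [outerRadius, innerRadius, sub_eq_add_neg]

lemma radicand_eq (t r : ℝ) :
    (1 + t ^ 2) * Real.cosh r + 2 * t * Real.sinh r =
      (1 + t ^ 2) * (1 + 2 * Real.sinh (r / 2) ^ 2) +
        4 * t * (Real.sinh (r / 2) * Real.cosh (r / 2)) := by
  have h := Real.sinh_two_mul (r / 2)
  rw [mul_div_cancel₀ _ two_ne_zero] at h
  rw [cosh_eq_one_add_two_mul_sinh_half_sq, h]
  ring

lemma radicand_pos (ht : |t| < 1) (r : ℝ) :
    0 < (1 + t ^ 2) * Real.cosh r + 2 * t * Real.sinh r := by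
  rw [abs_lt] at ht
  have h : (1 + t ^ 2) * Real.cosh r + 2 * t * Real.sinh r =
      ((1 + t) ^ 2 * Real.exp r + (1 - t) ^ 2 * Real.exp (-r)) / 2 := by
    rw [Real.cosh_eq, Real.sinh_eq]
    ring
  have : 0 < 1 + t := by linarith
  rw [h]
  positivity

lemma innerRadius_strictMonoOn (ht : |t| < 1) : StrictMonoOn (innerRadius t) (Ici 0) := by
  intro r hr q hq hrq
  have h1t : 0 < 1 - t ^ 2 := by nlinarith [abs_lt.1 ht]
  have hNr := radicand_pos ht r
  have hNq := radicand_pos ht q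
  have hs : 0 ≤ Real.sinh (r / 2) := Real.sinh_nonneg_iff.2 (div_nonneg hr zero_le_two)
  have hs' : 0 < Real.sinh (q / 2) := Real.sinh_pos_iff.2 (half_pos (lt_of_le_of_lt hr hrq))
  have hd : 0 < Real.sinh (q / 2) * Real.cosh (r / 2) - Real.cosh (q / 2) * Real.sinh (r / 2) := by
    rw [← Real.sinh_sub]
    exact Real.sinh_pos_iff.2 (by linarith)
  have hsq : Real.sinh (r / 2) ^ 2 * ((1 + t ^ 2) * Real.cosh q + 2 * t * Real.sinh q) <
      Real.sinh (q / 2) ^ 2 * ((1 + t ^ 2) * Real.cosh r + 2 * t * Real.sinh r) := by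
    rw [radicand_eq, radicand_eq]
    have hC := Real.cosh_sq (r / 2)
    have hC' := Real.cosh_sq (q / 2)
    have hlt := Real.sinh_lt_cosh (r / 2)
    have hlt' := (Real.sinh_lt_cosh (q / 2)).le
    set s := Real.sinh (r / 2)
    set s' := Real.sinh (q / 2)
    set C := Real.cosh (r / 2)
    set C' := Real.cosh (q / 2)
    -- The difference of the two sides of `hsq` factors as sinh ((q - r)/2) times this expression,
    -- which exceeds 2(1+t)² s s'.
    have key : 0 < (1 + t ^ 2) * (s * C' + C * s') + 4 * t * (s * s') := by
      have h₁ : s * s' ≤ s * C' := by gcongr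
      have h₂ : s * s' < C * s' := by gcongr
      have h₃ : 0 ≤ s * s' := by positivity
      have h₄ : (1 + t ^ 2) * (2 * (s * s')) < (1 + t ^ 2) * (s * C' + C * s') := by
        gcongr
        linarith
      nlinarith [mul_nonneg (sq_nonneg (1 + t)) h₃]
    have := mul_pos hd key
    linear_combination this + (1 + t ^ 2) * s' ^ 2 * hC - (1 + t ^ 2) * s ^ 2 * hC'
  have h : Real.sinh (r / 2) * √((1 + t ^ 2) * Real.cosh q + 2 * t * Real.sinh q) <
      Real.sinh (q / 2) * √((1 + t ^ 2) * Real.cosh r + 2 * t * Real.sinh r) := by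
    refine (pow_lt_pow_iff_left₀ (by positivity) (by positivity) two_ne_zero).1 ?_
    rw [mul_pow, mul_pow, Real.sq_sqrt hNq.le, Real.sq_sqrt hNr.le]
    exact hsq
  have h₁ := Real.sqrt_pos.2 hNr
  have h₂ := Real.sqrt_pos.2 hNq
  rw [innerRadius, innerRadius, div_lt_div_iff₀ (by positivity) (by positivity)]
  calc _ = (1 - t ^ 2) * √(1 + t ^ 2) *
        (Real.sinh (r / 2) * √((1 + t ^ 2) * Real.cosh q + 2 * t * Real.sinh q)) := by ring
    _ < (1 - t ^ 2) * √(1 + t ^ 2) *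
        (Real.sinh (q / 2) * √((1 + t ^ 2) * Real.cosh r + 2 * t * Real.sinh r)) := by gcongr
    _ = _ := by ring

lemma continuous_innerRadius (ht : |t| < 1) : Continuous (innerRadius t) := by
  unfold innerRadius
  refine Continuous.div (by fun_prop) (by fun_prop) fun r => ?_
  have := Real.sqrt_pos.2 (radicand_pos ht r)
  positivity

/-- Keeps sinh (r/2)/√radicand below its limit as r → ∞, hence m(r) below (1-t)/(√2 √(1+t²)), the
chordal distance to the unit sphere. -/
lemma two_mul_sinh_half_sq_le_radicand (ht : 0 ≤ t) (hr : 0 ≤ r) :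
    2 * (1 + t) ^ 2 * Real.sinh (r / 2) ^ 2 ≤ (1 + t ^ 2) * Real.cosh r + 2 * t * Real.sinh r := by
  have hs : 0 ≤ Real.sinh (r / 2) := Real.sinh_nonneg_iff.2 (by positivity)
  have h : t * (Real.sinh (r / 2) * Real.sinh (r / 2)) ≤
      t * (Real.sinh (r / 2) * Real.cosh (r / 2)) := by
    gcongr
    exact (Real.sinh_lt_cosh _).le
  rw [radicand_eq]
  nlinarith

lemma tendsto_outerRadius_div_innerRadius (ht : |t| < 1) :
    Tendsto (fun r => outerRadius t r / innerRadius t r) (𝓝[>] 0) (𝓝 1) := by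
  have hneg : |-t| < 1 := by rwa [abs_neg]
  have h1t : 0 < 1 - t ^ 2 := by nlinarith [abs_lt.1 ht]
  have hc : Continuous fun r => √((1 + t ^ 2) * Real.cosh r + 2 * t * Real.sinh r) /
      √((1 + (-t) ^ 2) * Real.cosh r + 2 * (-t) * Real.sinh r) :=
    Continuous.div (by fun_prop) (by fun_prop) fun r =>
      (Real.sqrt_pos.2 (radicand_pos hneg r)).ne'
  have h := (hc.tendsto 0).mono_left (nhdsWithin_le_nhds (s := Ioi 0))
  simp only [Real.cosh_zero, Real.sinh_zero, mul_one, mul_zero, add_zero, neg_sq] at h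
  rw [div_self (by positivity)] at h
  refine h.congr' ?_
  filter_upwards [self_mem_nhdsWithin] with r hr
  have hs : 0 < Real.sinh (r / 2) := Real.sinh_pos_iff.2 (half_pos hr)
  have h₁ := Real.sqrt_pos.2 (radicand_pos ht r)
  have h₂ := Real.sqrt_pos.2 (radicand_pos hneg r)
  rw [neg_sq] at h₂
  rw [outerRadius_eq_innerRadius_neg, innerRadius, innerRadius, neg_sq]
  field_simp

end Radii

/-! ### Chordal distance in terms of hyperbolic distance. -/

section ChordalBounds

variable {n : ℕ} {x y : EuclideanSpace ℝ (Fin n)}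

lemma chordalDist_coe (x y : EuclideanSpace ℝ (Fin n)) :
    chordalDist (x : OnePoint (EuclideanSpace ℝ (Fin n))) y =
      ‖x - y‖ / (√(1 + ‖x‖ ^ 2) * √(1 + ‖y‖ ^ 2)) := rfl

lemma chordalDist_eq_of_mem_ball (hx : ‖x‖ < 1) (hy : ‖y‖ < 1) :
    chordalDist (x : OnePoint (EuclideanSpace ℝ (Fin n))) y =
      (1 - ‖x‖ ^ 2) * Real.sinh (ballDist x y / 2) /
        (√(1 + ‖x‖ ^ 2) * √((1 - ‖x‖ ^ 2) * hyperboloidTime y)) := by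
  have h₁ := one_sub_norm_sq_pos hx
  have h₂ := one_sub_norm_sq_pos hy
  have h₃ := Real.sqrt_pos.2 h₁
  have h₄ := Real.sqrt_pos.2 h₂
  rw [chordalDist_coe, norm_sub_eq_mul_sinh hx hy, hyperboloidTime, Real.sqrt_mul h₁.le,
    Real.sqrt_div (by positivity)]
  field_simp
  rw [Real.sq_sqrt h₁.le]

lemma cosh_ballDist_zero (hy : ‖y‖ < 1) : Real.cosh (ballDist 0 y) = hyperboloidTime y := by
  rw [cosh_ballDist (by simp) hy]
  simp [hyperboloidTime, hyperboloidSpace]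

lemma sinh_ballDist_zero (hy : ‖y‖ < 1) :
    Real.sinh (ballDist 0 y) = 2 * ‖y‖ / (1 - ‖y‖ ^ 2) := by
  have h₁ := one_sub_norm_sq_pos hy
  refine (pow_left_inj₀ (Real.sinh_nonneg_iff.2 (ballDist_nonneg _ _)) (by positivity)
    two_ne_zero).1 ?_
  rw [Real.sinh_sq, cosh_ballDist_zero hy, hyperboloidTime]
  field_simp
  ring

/-- This is cosh applied to ρ(0,y) ≤ ρ(0,x) + ρ(x,y); the companion lower bound uses the reverse
triangle inequality. -/
lemma hyperboloidTime_le (hx : ‖x‖ < 1) (hy : ‖y‖ < 1) :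
    (1 - ‖x‖ ^ 2) * hyperboloidTime y ≤
      (1 + ‖x‖ ^ 2) * Real.cosh (ballDist x y) + 2 * ‖x‖ * Real.sinh (ballDist x y) := by
  have h₁ := one_sub_norm_sq_pos hx
  have h : Real.cosh (ballDist 0 y) ≤ Real.cosh (ballDist 0 x + ballDist x y) := by
    rw [Real.cosh_le_cosh, abs_of_nonneg (ballDist_nonneg _ _),
      abs_of_nonneg (add_nonneg (ballDist_nonneg _ _) (ballDist_nonneg _ _))]
    exact ballDist_triangle (by simp) hx hy
  rw [Real.cosh_add, cosh_ballDist_zero hy, cosh_ballDist_zero hx, sinh_ballDist_zero hx] at h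
  refine (mul_le_mul_of_nonneg_left h h₁.le).trans_eq ?_
  rw [hyperboloidTime]
  field_simp

lemma le_hyperboloidTime (hx : ‖x‖ < 1) (hy : ‖y‖ < 1) :
    (1 + ‖x‖ ^ 2) * Real.cosh (ballDist x y) - 2 * ‖x‖ * Real.sinh (ballDist x y) ≤
      (1 - ‖x‖ ^ 2) * hyperboloidTime y := by
  have h₁ := one_sub_norm_sq_pos hx
  have h0 : ‖(0 : EuclideanSpace ℝ (Fin n))‖ < 1 := by simp
  have h : Real.cosh (ballDist 0 x - ballDist x y) ≤ Real.cosh (ballDist 0 y) := by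
    rw [Real.cosh_le_cosh, abs_of_nonneg (ballDist_nonneg 0 y), abs_le]
    have t₁ := ballDist_triangle h0 hy hx
    have t₂ := ballDist_triangle hx h0 hy
    rw [ballDist_comm y x] at t₁
    rw [ballDist_comm x 0] at t₂
    constructor <;> linarith
  rw [Real.cosh_sub, cosh_ballDist_zero hy, cosh_ballDist_zero hx, sinh_ballDist_zero hx] at h
  refine Eq.trans_le ?_ (mul_le_mul_of_nonneg_left h h₁.le)
  rw [hyperboloidTime]
  field_simp

lemma innerRadius_le_chordalDist (hx : ‖x‖ < 1) (hy : ‖y‖ < 1) :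
    innerRadius ‖x‖ (ballDist x y) ≤ chordalDist (x : OnePoint (EuclideanSpace ℝ (Fin n))) y := by
  have h₁ := one_sub_norm_sq_pos hx
  have h₂ := Real.sqrt_pos.2 (mul_pos h₁ (hyperboloidTime_pos hy))
  have h₃ : 0 ≤ Real.sinh (ballDist x y / 2) :=
    Real.sinh_nonneg_iff.2 (by linarith [ballDist_nonneg x y])
  rw [chordalDist_eq_of_mem_ball hx hy, innerRadius]
  gcongr
  exact hyperboloidTime_le hx hy

lemma chordalDist_le_outerRadius (hx : ‖x‖ < 1) (hy : ‖y‖ < 1) :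
    chordalDist (x : OnePoint (EuclideanSpace ℝ (Fin n))) y ≤ outerRadius ‖x‖ (ballDist x y) := by
  have h₁ := one_sub_norm_sq_pos hx
  have h₂ := radicand_pos (t := -‖x‖) (by simpa using hx) (ballDist x y)
  rw [neg_sq, mul_neg, neg_mul, ← sub_eq_add_neg] at h₂
  have h₂ := Real.sqrt_pos.2 h₂
  have h₃ : 0 ≤ Real.sinh (ballDist x y / 2) :=
    Real.sinh_nonneg_iff.2 (by linarith [ballDist_nonneg x y])
  rw [chordalDist_eq_of_mem_ball hx hy, outerRadius]
  gcongr
  exact le_hyperboloidTime hx hy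

lemma innerRadius_le_chordalDist_of_one_le (hx : ‖x‖ < 1) (hy : 1 ≤ ‖y‖) {r : ℝ} (hr : 0 ≤ r) :
    innerRadius ‖x‖ r ≤ chordalDist (x : OnePoint (EuclideanSpace ℝ (Fin n))) y := by
  have h₁ := one_sub_norm_sq_pos hx
  have hs : 0 ≤ Real.sinh (r / 2) := Real.sinh_nonneg_iff.2 (by linarith)
  have hN := two_mul_sinh_half_sq_le_radicand (norm_nonneg x) hr
  have hN0 := radicand_pos (t := ‖x‖) (by simpa using hx) r
  have hN1 := Real.sqrt_pos.2 hN0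
  have hxy : ‖y‖ - ‖x‖ ≤ ‖x - y‖ := by
    rw [norm_sub_rev]
    exact norm_sub_norm_le y x
  have hx0 := norm_nonneg x
  -- Among |y| ≥ 1, the quotient (|y| - |x|)/√(1 + |y|²) is least at |y| = 1.
  have hq : (1 - ‖x‖) ^ 2 * (1 + ‖y‖ ^ 2) ≤ 2 * (‖y‖ - ‖x‖) ^ 2 := by
    have h : 2 * (‖y‖ - ‖x‖) ^ 2 - (1 - ‖x‖) ^ 2 * (1 + ‖y‖ ^ 2) =
        (‖y‖ - 1) * ((1 + 2 * ‖x‖ - ‖x‖ ^ 2) * (‖y‖ - 1) + 2 * (1 - ‖x‖ ^ 2)) := by ring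
    have : 0 ≤ 1 + 2 * ‖x‖ - ‖x‖ ^ 2 := by nlinarith
    have : 0 ≤ ‖y‖ - 1 := by linarith
    have : 0 ≤ 2 * (‖y‖ - ‖x‖) ^ 2 - (1 - ‖x‖) ^ 2 * (1 + ‖y‖ ^ 2) := by
      rw [h]
      positivity
    linarith
  have h : (1 - ‖x‖ ^ 2) * Real.sinh (r / 2) * √(1 + ‖y‖ ^ 2) ≤
      ‖x - y‖ * √((1 + ‖x‖ ^ 2) * Real.cosh r + 2 * ‖x‖ * Real.sinh r) := by
    refine (pow_le_pow_iff_left₀ (by positivity) (by positivity) two_ne_zero).1 ?_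
    rw [mul_pow, mul_pow, mul_pow, Real.sq_sqrt hN0.le, Real.sq_sqrt (by positivity)]
    calc _ = (1 + ‖x‖) ^ 2 * Real.sinh (r / 2) ^ 2 * ((1 - ‖x‖) ^ 2 * (1 + ‖y‖ ^ 2)) := by ring
      _ ≤ (1 + ‖x‖) ^ 2 * Real.sinh (r / 2) ^ 2 * (2 * (‖y‖ - ‖x‖) ^ 2) := by gcongr
      _ = (‖y‖ - ‖x‖) ^ 2 * (2 * (1 + ‖x‖) ^ 2 * Real.sinh (r / 2) ^ 2) := by ring
      _ ≤ _ := by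
        gcongr
        linarith
  rw [chordalDist_coe, innerRadius, div_le_div_iff₀ (by positivity) (by positivity)]
  calc _ = √(1 + ‖x‖ ^ 2) * ((1 - ‖x‖ ^ 2) * Real.sinh (r / 2) * √(1 + ‖y‖ ^ 2)) := by ring
    _ ≤ √(1 + ‖x‖ ^ 2) *
        (‖x - y‖ * √((1 + ‖x‖ ^ 2) * Real.cosh r + 2 * ‖x‖ * Real.sinh r)) := by gcongr
    _ = _ := by ring

lemma innerRadius_le_chordalDist_infty (hx : ‖x‖ < 1) {r : ℝ} (hr : 0 ≤ r) :
    innerRadius ‖x‖ r ≤ chordalDist (x : OnePoint (EuclideanSpace ℝ (Fin n))) ∞ := by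
  have hs : 0 ≤ Real.sinh (r / 2) := Real.sinh_nonneg_iff.2 (by linarith)
  have hN := two_mul_sinh_half_sq_le_radicand (norm_nonneg x) hr
  have hN0 := Real.sqrt_pos.2 (radicand_pos (t := ‖x‖) (by simpa using hx) r)
  have hx0 := norm_nonneg x
  have h : (1 - ‖x‖ ^ 2) * Real.sinh (r / 2) ≤
      √((1 + ‖x‖ ^ 2) * Real.cosh r + 2 * ‖x‖ * Real.sinh r) := by
    refine Real.le_sqrt_of_sq_le (le_trans ?_ hN)
    rw [mul_pow]
    gcongr
    have : (1 - ‖x‖ ^ 2) ^ 2 ≤ 1 := by nlinarith [sq_nonneg ‖x‖, one_sub_norm_sq_pos hx]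
    nlinarith
  change _ ≤ 1 / √(1 + ‖x‖ ^ 2)
  rw [innerRadius, div_le_div_iff₀ (by positivity) (by positivity)]
  calc _ = √(1 + ‖x‖ ^ 2) * ((1 - ‖x‖ ^ 2) * Real.sinh (r / 2)) := by ring
    _ ≤ √(1 + ‖x‖ ^ 2) * √((1 + ‖x‖ ^ 2) * Real.cosh r + 2 * ‖x‖ * Real.sinh r) := by gcongr
    _ = _ := by ring

/-- On each hyperbolic sphere about a point of a line through the origin, the bounds for the
chordal distance are attained on that line. -/
lemma exists_ballDist_eq_chordalDist_eq_innerRadius {e : EuclideanSpace ℝ (Fin n)} (he : ‖e‖ = 1)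
    {τ r : ℝ} (hτ : |τ| < 1) (hr : 0 ≤ r) :
    ∃ y : EuclideanSpace ℝ (Fin n), ‖y‖ < 1 ∧ ballDist (τ • e) y = r ∧
      chordalDist ((τ • e : EuclideanSpace ℝ (Fin n)) : OnePoint (EuclideanSpace ℝ (Fin n))) y =
        innerRadius τ r := by
  have hnorm : ∀ v : ℝ, ‖v • e‖ ^ 2 = v ^ 2 := fun v => by
    rw [norm_smul, he, mul_one, Real.norm_eq_abs, sq_abs]
  have hτ' : 0 < 1 - τ ^ 2 := by nlinarith [abs_lt.1 hτ]
  have hC := Real.cosh_sq (r / 2)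
  have hsC := Real.sinh_lt_cosh (r / 2)
  have hs : 0 ≤ Real.sinh (r / 2) := Real.sinh_nonneg_iff.2 (by linarith)
  have hN := radicand_eq τ r
  have hden : 0 < Real.cosh (r / 2) + τ * Real.sinh (r / 2) := by nlinarith [abs_lt.1 hτ]
  set s := Real.sinh (r / 2) with hs_def
  set C := Real.cosh (r / 2)
  -- Möbius addition of τ and tanh (r/2): the move from τ through hyperbolic distance r in the
  -- direction of e.
  set v := (τ * C + s) / (C + τ * s) with hv
  have h1v : 1 - v ^ 2 = (1 - τ ^ 2) / (C + τ * s) ^ 2 := by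
    rw [hv]
    field_simp
    linear_combination (1 - τ ^ 2) * hC
  have hx : ‖τ • e‖ < 1 := by rwa [norm_smul, he, mul_one, Real.norm_eq_abs]
  have hy : ‖v • e‖ < 1 := by
    have : 0 < 1 - v ^ 2 := by rw [h1v]; positivity
    refine (sq_lt_one_iff₀ (norm_nonneg _)).1 ?_
    rw [hnorm]
    linarith
  have hdist : ballDist (τ • e) (v • e) = r := by
    refine eq_ballDist_of_sinh_half_sq hx hy hr ?_
    rw [← sub_smul, hnorm, hnorm, hnorm, h1v, hv, ← hs_def]
    field_simp
    ring
  have htime : (1 - τ ^ 2) * hyperboloidTime (v • e) =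
      (1 + τ ^ 2) * Real.cosh r + 2 * τ * Real.sinh r := by
    rw [hyperboloidTime, hnorm, h1v, hN, hv]
    field_simp
    linear_combination (1 + τ ^ 2) * hC
  refine ⟨v • e, hy, hdist, ?_⟩
  rw [chordalDist_eq_of_mem_ball hx hy, hdist, hnorm, htime, innerRadius]

/-- At x = 0 any direction serves, and n ≥ 1 supplies one. -/
lemma exists_norm_eq_one_norm_smul_eq (hn : 1 ≤ n) (x : EuclideanSpace ℝ (Fin n)) :
    ∃ e : EuclideanSpace ℝ (Fin n), ‖e‖ = 1 ∧ ‖x‖ • e = x := by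
  have : Nonempty (Fin n) := ⟨⟨0, hn⟩⟩
  rcases eq_or_ne x 0 with rfl | hx
  · obtain ⟨e, he⟩ := exists_norm_eq (EuclideanSpace ℝ (Fin n)) zero_le_one
    exact ⟨e, he, by simp⟩
  · have := norm_ne_zero_iff.2 hx
    exact ⟨‖x‖⁻¹ • x, by rw [norm_smul, norm_inv, norm_norm, inv_mul_cancel₀ this],
      by rw [smul_smul, mul_inv_cancel₀ this, one_smul]⟩

lemma coe_mem_hyperbolicBall (hx : ‖x‖ < 1) {r : ℝ} :
    (y : OnePoint (EuclideanSpace ℝ (Fin n))) ∈ hyperbolicBall x r ↔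
      ‖y‖ < 1 ∧ ballDist x y < r := by
  rw [hyperbolicBall, OnePoint.coe_injective.mem_set_image, metricBall, mem_ofPred_eq, mem_unitBall,
    and_congr_right_iff]
  intro hy
  rw [hyperbolicDist_eq_ballDist hx hy]

lemma mem_chordalBall {z : OnePoint (EuclideanSpace ℝ (Fin n))} {s : ℝ} :
    z ∈ chordalBall x s ↔ chordalDist (x : OnePoint (EuclideanSpace ℝ (Fin n))) z < s :=
  and_iff_right (mem_univ z)

end ChordalBounds

theorem theorem3p10 (n : ℕ) (hn : 1 ≤ n) (x : EuclideanSpace ℝ (Fin n)) (hx : x ∈ unitBall n) :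
    (∀ r : ℝ, 0 < r →
      chordalBall x (innerRadius ‖x‖ r) ⊆ hyperbolicBall x r ∧
      hyperbolicBall x r ⊆ chordalBall x (outerRadius ‖x‖ r) ∧
      (∀ s : ℝ, chordalBall x s ⊆ hyperbolicBall x r → s ≤ innerRadius ‖x‖ r) ∧
      (∀ s : ℝ, hyperbolicBall x r ⊆ chordalBall x s → outerRadius ‖x‖ r ≤ s)) ∧
    Tendsto (fun r : ℝ => outerRadius ‖x‖ r / innerRadius ‖x‖ r) (𝓝[>] 0) (𝓝 1) := by
  rw [mem_unitBall] at hx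
  have ht : |‖x‖| < 1 := by rwa [abs_norm]
  have ht' : |-‖x‖| < 1 := by rwa [abs_neg]
  obtain ⟨e, he, hxe⟩ := exists_norm_eq_one_norm_smul_eq hn x
  refine ⟨fun r hr => ⟨?_, ?_, ?_, ?_⟩, tendsto_outerRadius_div_innerRadius ht⟩
  · intro z hz
    rw [mem_chordalBall] at hz
    induction z using OnePoint.rec with
    | infty => exact absurd hz (innerRadius_le_chordalDist_infty hx hr.le).not_gt
    | coe y =>
      have hy : ‖y‖ < 1 := lt_of_not_ge fun hy =>
        absurd hz (innerRadius_le_chordalDist_of_one_le hx hy hr.le).not_gt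
      refine (coe_mem_hyperbolicBall hx).2 ⟨hy, lt_of_not_ge fun hle => absurd hz ?_⟩
      exact (((innerRadius_strictMonoOn ht).monotoneOn hr.le (hr.le.trans hle) hle).trans
        (innerRadius_le_chordalDist hx hy)).not_gt
  · rintro _ ⟨y, hy, rfl⟩
    obtain ⟨hy, hlt⟩ := (coe_mem_hyperbolicBall hx).1 ⟨y, hy, rfl⟩
    rw [mem_chordalBall]
    refine (chordalDist_le_outerRadius hx hy).trans_lt ?_
    rw [outerRadius_eq_innerRadius_neg, outerRadius_eq_innerRadius_neg]
    exact innerRadius_strictMonoOn ht' (ballDist_nonneg x y) hr.le hlt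
  · intro s hs
    obtain ⟨y, hy, hd, hq⟩ := exists_ballDist_eq_chordalDist_eq_innerRadius he ht hr.le
    rw [hxe] at hd hq
    by_contra! hlt
    rw [← hq] at hlt
    -- The extremal point lies on the hyperbolic sphere of radius r, so outside the open ball.
    exact hd.not_lt ((coe_mem_hyperbolicBall hx).1 (hs (mem_chordalBall.2 hlt))).2
  · intro s hs
    rw [outerRadius_eq_innerRadius_neg]
    -- The extremal point for M(r) is not in the open ball, so extremal points at radii q < r are
    -- used and q → r.
    refine le_of_tendsto (((continuous_innerRadius ht').tendsto r).mono_left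
      (nhdsWithin_le_nhds (s := Iio r))) ?_
    filter_upwards [Ioo_mem_nhdsLT hr] with q hq
    -- Reversing both e and the sign of |x| keeps the centre x but moves from it towards the origin.
    obtain ⟨y, hy, hd, hqy⟩ := exists_ballDist_eq_chordalDist_eq_innerRadius (e := -e)
      (by rwa [norm_neg]) ht' hq.1.le
    rw [neg_smul_neg, hxe] at hd hqy
    rw [← hqy]
    exact (mem_chordalBall.1 (hs ((coe_mem_hyperbolicBall hx).2 ⟨hy, hd.trans_lt hq.2⟩))).le
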